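/- Let $C\subset\mathbb{R}^3$ be a cube with center $a$, let $0<t<1$, and let $C'$ be the image of $C$ under the homothety of ratio $t$ with center $a$ (so $C$ and $C'$ are two nested cubes whose edge lengths have ratio $t$). Let $q_1,\dots,q_8$ be the vertices of $C$, let $q_9,\dots,q_{16}$ be the vertices of $C'$, and let positive masses $m_1,\dots,m_{16}>0$ be placed at $q_1,\dots,q_{16}$. Suppose that the configuration is a central configuration, i.e. that there is $\lambda\in\mathbb{R}$ such that $$-\lambda\,(q_i-q_0)=\sum_{j\neq i} m_j\,\frac{q_j-q_i}{|q_j-q_i|^3},\qquad i=1,\dots,16,\qquad\text{where } q_0=\frac{\sum_{j} m_jq_j}{\sum_{j} m_j}.$$ Then the masses on each cube are equal: $m_1=\dots=m_8$ and $m_9=\dots=m_{16}$. -/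

import Mathlib

/-- A configuration `q` of finitely many point masses `m` is *central* if there is `lam : ℝ` with
`-lam (q i - q₀) = ∑_{j ≠ i} m j (q j - q i) / |q j - q i|³` for all `i`,
where `q₀ = (∑ m j q j) / (∑ m j)` is the center of mass.
(It is meant for positive masses at pairwise distinct positions.) -/
def IsCentralConfiguration {ι E : Type*} [Fintype ι] [DecidableEq ι]
    [NormedAddCommGroup E] [InnerProductSpace ℝ E] (m : ι → ℝ) (q : ι → E) : Prop :=
  ∃ lam : ℝ, ∀ i : ι,
    -lam • (q i - Finset.univ.centerMass m q) =
      ∑ j ∈ Finset.univ.erase i, (m j / ‖q j - q i‖ ^ 3) • (q j - q i)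

/-- The vertices of the cube in `ℝ³` with center `a`, edge directions given by the orthonormal
basis `b`, and edge length `2 * r`: the vertex labelled by the signs `ε = (ε₀, ε₁, ε₂)`, each
`1` or `-1`, is `a + r (ε₀ b₀ + ε₁ b₁ + ε₂ b₂)`. -/
noncomputable def cubeVertex (a : EuclideanSpace ℝ (Fin 3))
    (b : OrthonormalBasis (Fin 3) ℝ (EuclideanSpace ℝ (Fin 3))) (r : ℝ)
    (ε : Fin 3 → ℤˣ) : EuclideanSpace ℝ (Fin 3) :=
  a + r • ∑ k : Fin 3, ((ε k : ℤ) : ℝ) • b k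

/-- The 16 positions of two nested (concentric, homothetic) cubes whose edge lengths have ratio
`t`: the left summand labels the vertices of the cube of edge `2 * r`, the right summand the
corresponding vertices of its image under the homothety of ratio `t` about the center `a`. -/
noncomputable def nestedCubes (a : EuclideanSpace ℝ (Fin 3))
    (b : OrthonormalBasis (Fin 3) ℝ (EuclideanSpace ℝ (Fin 3))) (r t : ℝ) :
    (Fin 3 → ℤˣ) ⊕ (Fin 3 → ℤˣ) → EuclideanSpace ℝ (Fin 3) :=
  Sum.elim (cubeVertex a b r) (cubeVertex a b (t * r))

/-! ### Inequalities between the inverse cubes of the mutual distances -/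

/-! The group `{±1}³` permutes the vertices of each cube simply transitively, so the `k`-th
coordinate of the equations, multiplied by `ε k`, is a pair of convolution equations for the two
mass functions. For a character `S ≠ ∅, {k}` the left side drops out (`fourier_equation`), leaving a
homogeneous 2×2 system for the two Fourier coefficients. Its diagonal entries have the same sign by
scaling; for a suitable `k` its off-diagonal entries have opposite signs
(`exists_sum_vertexForce_neg_pos`). The determinant is then positive, all nontrivial coefficients
vanish, and the masses are constant on each cube. -/

lemma inv_cube_le_of_sq {c s : ℝ} (hc : 0 < c) (hs : 0 < s) :
    1 / s ^ 3 ≤ (c ^ 2 * s ^ 2 + 1) / (2 * c * (s ^ 2) ^ 2) := by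
  rw [div_le_div_iff₀ (by positivity) (by positivity)]
  -- AM-GM, `2 * c * s ≤ c ^ 2 * s ^ 2 + 1`, makes the bound rational in `s ^ 2`; it is sharp at `s
  -- = 1 / c`.
  have h : 0 ≤ s ^ 3 * (c * s - 1) ^ 2 := by positivity
  nlinarith [h]

/-- The convex function `1 / √u` lies above its tangent at `u = c ^ 2`; divide by `u = s ^ 2`. -/
lemma le_inv_cube_of_sq {c s : ℝ} (hc : 0 < c) (hs : 0 < s) :
    (3 * c ^ 2 - s ^ 2) / (2 * c ^ 3 * s ^ 2) ≤ 1 / s ^ 3 := by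
  rw [div_le_div_iff₀ (by positivity) (by positivity)]
  have h : 0 ≤ s ^ 2 * ((c - s) ^ 2 * (2 * c + s)) := by positivity
  nlinarith [h]

lemma add_inv_sq_one_sub_one_add {t : ℝ} (ht0 : 0 < t) (ht1 : t < 1) :
    2 + 2 * t ^ 2 < 1 / (1 - t) ^ 2 + 1 / (1 + t) ^ 2 := by
  have h1 : 0 < 1 - t := by linarith
  have h2 : 0 < 1 + t := by linarith
  rw [div_add_div _ _ (by positivity) (by positivity), lt_div_iff₀ (by positivity)]
  have h3 : 0 < t ^ 2 := by positivity
  have h4 : t ^ 2 < 1 := by nlinarith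
  nlinarith [mul_pos h3 (sub_pos.2 h4), mul_pos (mul_pos h3 h3) (sub_pos.2 h4)]

lemma sub_inv_sq_one_sub_one_add {t : ℝ} (ht0 : 0 < t) (ht1 : t < 1) :
    4 * t < 1 / (1 - t) ^ 2 - 1 / (1 + t) ^ 2 := by
  have h1 : 0 < 1 - t := by linarith
  have h2 : 0 < 1 + t := by linarith
  rw [div_sub_div _ _ (by positivity) (by positivity), lt_div_iff₀ (by positivity)]
  have h3 : 0 < t ^ 2 := by positivity
  have h4 : t ^ 2 < 1 := by nlinarith
  nlinarith [mul_pos ht0 (mul_pos h3 (sub_pos.2 h4)), mul_pos ht0 h3]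

/-- The polynomial `2 + 2 * t ^ 2` separates the `ρ₁, ρ₂` terms from the `ρ₀, ρ₃` terms in
`NestedKernel.first`; `4 * t` does so for `NestedKernel.second`. -/
lemma mul_inv_cube_add_le {t s₁ s₂ : ℝ} (ht0 : 0 < t) (ht1 : t < 1) (h₁ : 0 < s₁) (h₂ : 0 < s₂)
    (hs₁ : s₁ ^ 2 = 1 - 2 * t / 3 + t ^ 2) (hs₂ : s₂ ^ 2 = 1 + 2 * t / 3 + t ^ 2) :
    (1 + t) * (1 / s₁ ^ 3) + (1 - t) * (1 / s₂ ^ 3) ≤ 2 + 2 * t ^ 2 := by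
  have hα : 0 < 1 - 2 * t / 3 + t ^ 2 := hs₁ ▸ by positivity
  have hβ : 0 < 1 + 2 * t / 3 + t ^ 2 := by positivity
  have e₁ := inv_cube_le_of_sq one_pos h₁
  have e₂ := inv_cube_le_of_sq one_pos h₂
  rw [hs₁] at e₁
  rw [hs₂] at e₂
  refine (add_le_add (mul_le_mul_of_nonneg_left e₁ (by linarith))
    (mul_le_mul_of_nonneg_left e₂ (by linarith))).trans ?_
  rw [← mul_div_assoc, ← mul_div_assoc, div_add_div _ _ (by positivity) (by positivity),
    div_le_iff₀ (by positivity), ← sub_nonneg]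
  have : 0 ≤ 44 / 9 * t ^ 2 + 2960 / 81 * t ^ 4 + 4340 / 81 * t ^ 6 + 296 / 9 * t ^ 8
      + 8 * t ^ 10 := by positivity
  refine this.trans_eq ?_
  ring

lemma mul_inv_cube_sub_le {t s₁ s₂ : ℝ} (ht0 : 0 < t) (ht1 : t < 1) (h₁ : 0 < s₁) (h₂ : 0 < s₂)
    (hs₁ : s₁ ^ 2 = 1 - 2 * t / 3 + t ^ 2) (hs₂ : s₂ ^ 2 = 1 + 2 * t / 3 + t ^ 2) :
    (3 - t) * (1 / s₁ ^ 3) - (3 + t) * (1 / s₂ ^ 3) ≤ 4 * t := by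
  have hα : 0 < 1 - 2 * t / 3 + t ^ 2 := hs₁ ▸ by positivity
  have hβ : 0 < 1 + 2 * t / 3 + t ^ 2 := by positivity
  -- To first order in `t`, `s₂` is `1 + t / 3` and `s₁` is its inverse, so this one `c` makes both
  -- bounds nearly sharp.
  have hc : 0 < 1 + t / 3 := by positivity
  have e₁ := inv_cube_le_of_sq hc h₁
  have e₂ := le_inv_cube_of_sq hc h₂
  rw [hs₁] at e₁
  rw [hs₂] at e₂
  refine (sub_le_sub (mul_le_mul_of_nonneg_left e₁ (by linarith))
    (mul_le_mul_of_nonneg_left e₂ (by linarith))).trans ?_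
  rw [← mul_div_assoc, ← mul_div_assoc, div_sub_div _ _ (by positivity) (by positivity),
    div_le_iff₀ (by positivity), ← sub_nonneg]
  have : 0 ≤ 2 * (1 + t / 3) * (176 / 9 * t ^ 3 + 119 / 27 * t ^ 4 + 1741 / 81 * t ^ 5
      + 3118 / 243 * t ^ 6 + 2126 / 243 * t ^ 7 + 1723 / 243 * t ^ 8 + 67 / 27 * t ^ 9
      + 8 / 27 * t ^ 10) := by positivity
  refine this.trans_eq ?_
  ring

/-- The arithmetic mean of the inverse cubes dominates their geometric mean, which is at least `1 /
v ^ 3`. -/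
lemma two_mul_inv_cube_le {u v w : ℝ} (hu : 0 < u) (hv : 0 < v) (hw : 0 < w)
    (h : u * w ≤ v ^ 2) : 2 * (1 / v ^ 3) ≤ 1 / u ^ 3 + 1 / w ^ 3 := by
  have h1 : (u * w) ^ 3 ≤ (v ^ 2) ^ 3 := by gcongr
  have h2 : (1 / v ^ 3) ^ 2 ≤ 1 / u ^ 3 * (1 / w ^ 3) := by
    rw [div_mul_div_comm, div_pow, one_pow, one_mul]
    refine one_div_le_one_div_of_le (by positivity) ?_
    calc u ^ 3 * w ^ 3 = (u * w) ^ 3 := by ring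
      _ ≤ (v ^ 2) ^ 3 := h1
      _ = (v ^ 3) ^ 2 := by ring
  have hU : 0 < 1 / u ^ 3 := by positivity
  have hW : 0 < 1 / w ^ 3 := by positivity
  have hV : 0 < 1 / v ^ 3 := by positivity
  nlinarith [sq_nonneg (1 / u ^ 3 - 1 / w ^ 3)]

/-- The inequalities satisfied by `ρₙ = σₙ⁻³`, where `√3 σₙ` is the distance from a vertex `1` of
a cube to the vertex `t δ` of the smaller cube, `n` being the number of signs `-1` in `δ`. -/
structure NestedKernel (t ρ₀ ρ₁ ρ₂ ρ₃ : ℝ) : Prop where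
  lt₁₀ : ρ₁ < ρ₀
  lt₂₁ : ρ₂ < ρ₁
  lt₃₂ : ρ₃ < ρ₂
  convex : 2 * ρ₂ ≤ ρ₁ + ρ₃
  first : (1 + t) * (ρ₁ - ρ₃) < (1 - t) * (ρ₀ - ρ₂)
  second : (1 + t) * (ρ₁ - 2 * ρ₂ + ρ₃) < (1 - t) * (ρ₀ - 2 * ρ₁ + ρ₂)

lemma inv_cube_lt_inv_cube {u v : ℝ} (hu : 0 < u) (hv : 0 < v) (h : u ^ 2 < v ^ 2) :
    1 / v ^ 3 < 1 / u ^ 3 := by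
  have h' : u < v := lt_of_pow_lt_pow_left₀ 2 hv.le h
  exact one_div_lt_one_div_of_lt (by positivity) (by gcongr)

lemma nestedKernel_of_sq {t s₁ s₂ : ℝ} (ht0 : 0 < t) (ht1 : t < 1) (h₁ : 0 < s₁) (h₂ : 0 < s₂)
    (hs₁ : s₁ ^ 2 = 1 - 2 * t / 3 + t ^ 2) (hs₂ : s₂ ^ 2 = 1 + 2 * t / 3 + t ^ 2) :
    NestedKernel t (1 / (1 - t) ^ 3) (1 / s₁ ^ 3) (1 / s₂ ^ 3) (1 / (1 + t) ^ 3) := by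
  have hp : 0 < 1 - t := by linarith
  have hq : 0 < 1 + t := by linarith
  have e₀ : (1 - t) * (1 / (1 - t) ^ 3) = 1 / (1 - t) ^ 2 := by field_simp
  have e₃ : (1 + t) * (1 / (1 + t) ^ 3) = 1 / (1 + t) ^ 2 := by field_simp
  refine ⟨inv_cube_lt_inv_cube hp h₁ ?_, inv_cube_lt_inv_cube h₁ h₂ ?_,
    inv_cube_lt_inv_cube h₂ hq ?_, two_mul_inv_cube_le h₁ h₂ hq ?_, ?_, ?_⟩
  · rw [hs₁]; nlinarith
  · rw [hs₁, hs₂]; linarith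
  · rw [hs₂]; nlinarith
  · refine le_of_sq_le_sq ?_ (by positivity)
    rw [mul_pow, hs₁, hs₂]
    nlinarith [sq_nonneg t, mul_pos ht0 ht0, mul_pos (mul_pos ht0 ht0) ht0]
  · nlinarith [add_inv_sq_one_sub_one_add ht0 ht1, mul_inv_cube_add_le ht0 ht1 h₁ h₂ hs₁ hs₂]
  · nlinarith [sub_inv_sq_one_sub_one_add ht0 ht1, mul_inv_cube_sub_le ht0 ht1 h₁ h₂ hs₁ hs₂]

/-! ### Characters of the group of sign vectors -/

/-- The character of the group `{±1}³` attached to a set of coordinates. -/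
noncomputable def signChar (S : Finset (Fin 3)) (ε : Fin 3 → ℤˣ) : ℝ :=
  ∏ k ∈ S, ((ε k : ℤ) : ℝ)

lemma signChar_mul (S : Finset (Fin 3)) (ε η : Fin 3 → ℤˣ) :
    signChar S (ε * η) = signChar S ε * signChar S η := by
  simp [signChar, Finset.prod_mul_distrib]

lemma sum_signChar {S : Finset (Fin 3)} (hS : S ≠ ∅) : ∑ ε, signChar S ε = 0 := by
  have h : ∀ S : Finset (Fin 3), S ≠ ∅ →
      ∑ ε : Fin 3 → ℤˣ, ∏ k ∈ S, (ε k : ℤ) = 0 := by decide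
  simp only [signChar]
  exact_mod_cast h S hS

lemma sum_signChar_mul {S : Finset (Fin 3)} {k : Fin 3} (hS : S ≠ {k}) :
    ∑ ε, signChar S ε * ((ε k : ℤ) : ℝ) = 0 := by
  have h : ∀ (S : Finset (Fin 3)) (k : Fin 3), S ≠ {k} →
      ∑ ε : Fin 3 → ℤˣ, (∏ k ∈ S, (ε k : ℤ)) * (ε k : ℤ) = 0 := by decide
  simp only [signChar]
  exact_mod_cast h S k hS

lemma prod_one_add_sign (ε η : Fin 3 → ℤˣ) :
    ∏ k, (1 + ((ε k : ℤ) : ℝ) * ((η k : ℤ) : ℝ)) = if η = ε then 8 else 0 := by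
  have h : ∀ ε η : Fin 3 → ℤˣ,
      ∏ k, (1 + (ε k : ℤ) * (η k : ℤ)) = if η = ε then 8 else 0 := by decide
  exact_mod_cast h ε η

/-- Fourier inversion: a function orthogonal to the nontrivial characters is constant. -/
lemma eq_of_sum_signChar_mul_eq_zero {f : (Fin 3 → ℤˣ) → ℝ}
    (hf : ∀ S : Finset (Fin 3), S ≠ ∅ → ∑ ε, signChar S ε * f ε = 0) (ε η : Fin 3 → ℤˣ) :
    f ε = f η := by
  suffices h : ∀ ε, 8 * f ε = ∑ η, f η by linarith [h ε, h η]
  intro ε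
  calc 8 * f ε = ∑ η, (∏ k, (1 + ((ε k : ℤ) : ℝ) * ((η k : ℤ) : ℝ))) * f η := by
        simp [prod_one_add_sign]
    _ = ∑ η, ∑ S : Finset (Fin 3), signChar S ε * (signChar S η * f η) := by
        refine Finset.sum_congr rfl fun η _ => ?_
        rw [Finset.prod_one_add, Finset.powerset_univ, Finset.sum_mul]
        simp only [signChar, Finset.prod_mul_distrib, mul_assoc]
    _ = ∑ S : Finset (Fin 3), signChar S ε * ∑ η, signChar S η * f η := by
        rw [Finset.sum_comm]
        simp only [Finset.mul_sum]
    _ = ∑ η, f η := by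
        rw [Finset.sum_eq_single ∅ (fun S _ hS => by rw [hf S hS, mul_zero]) (by simp)]
        simp [signChar]

lemma signVector_mul_self (ε : Fin 3 → ℤˣ) : ε * ε = 1 := by
  ext k
  simp

/-- Characters diagonalize convolution on `{±1}³`. -/
lemma sum_signChar_mul_convolution (S : Finset (Fin 3)) (f φ : (Fin 3 → ℤˣ) → ℝ) :
    ∑ ε, signChar S ε * ∑ η, f η * φ (ε * η) =
      (∑ δ, signChar S δ * φ δ) * ∑ η, signChar S η * f η := by
  simp only [Finset.mul_sum]
  rw [Finset.sum_comm]
  refine Finset.sum_congr rfl fun η _ => ?_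
  rw [Finset.sum_mul, ← Equiv.sum_comp (Equiv.mulRight η)]
  refine Finset.sum_congr rfl fun δ _ => ?_
  simp only [Equiv.coe_mulRight, mul_assoc, signVector_mul_self, mul_one]
  rw [signChar_mul]
  ring

lemma sum_signs (f : (Fin 3 → ℤˣ) → ℝ) :
    ∑ δ, f δ = f ![1, 1, 1] + f ![-1, 1, 1] + f ![1, -1, 1] + f ![1, 1, -1] + f ![1, -1, -1]
      + f ![-1, 1, -1] + f ![-1, -1, 1] + f ![-1, -1, -1] := by
  have h : (Finset.univ : Finset (Fin 3 → ℤˣ)) = {![1, 1, 1], ![-1, 1, 1], ![1, -1, 1],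
      ![1, 1, -1], ![1, -1, -1], ![-1, 1, -1], ![-1, -1, 1], ![-1, -1, -1]} := by decide
  rw [h]
  repeat rw [Finset.sum_insert (by decide)]
  rw [Finset.sum_singleton]
  ring

/-- Multiplying by `δ k` toggles `k` in `S`, so only the transforms `W n` of `w` at sets of size `n`
occur. The sums are `t * W n' - W n` and `W n' - t * W n`, where `n = S.card` and `n' = n ± 1`.
Everything reduces to `t * W 1 < W 2`, `t * W 2 < W 3` (the fields `first`, `second`) and the
reversed pairs `g₁`, `g₂`. -/
lemma exists_sum_signChar_neg_pos {t ρ₀ ρ₁ ρ₂ ρ₃ : ℝ} (ht0 : 0 < t)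
    (h : NestedKernel t ρ₀ ρ₁ ρ₂ ρ₃) {w : (Fin 3 → ℤˣ) → ℝ}
    (h₀ : w ![1, 1, 1] = ρ₀) (h₁ : w ![-1, 1, 1] = ρ₁) (h₁' : w ![1, -1, 1] = ρ₁)
    (h₁'' : w ![1, 1, -1] = ρ₁) (h₂ : w ![1, -1, -1] = ρ₂) (h₂' : w ![-1, 1, -1] = ρ₂)
    (h₂'' : w ![-1, -1, 1] = ρ₂) (h₃ : w ![-1, -1, -1] = ρ₃)
    {S : Finset (Fin 3)} (hS : S ≠ ∅) :
    ∃ k, S ≠ {k} ∧ ∑ δ, signChar S δ * ((t * ((δ k : ℤ) : ℝ) - 1) * w δ) < 0 ∧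
      0 < ∑ δ, signChar S δ * ((((δ k : ℤ) : ℝ) - t) * w δ) := by
  obtain ⟨l₁, l₂, l₃, hc, f₁, f₂⟩ := h
  have g₁ : t * (ρ₀ - ρ₁ - ρ₂ + ρ₃) < ρ₀ + ρ₁ - ρ₂ - ρ₃ := by nlinarith
  have g₂ : t * (ρ₀ - 3 * ρ₁ + 3 * ρ₂ - ρ₃) < ρ₀ - ρ₁ - ρ₂ + ρ₃ := by nlinarith
  have hcases : ∀ S : Finset (Fin 3), S = ∅ ∨ S = {0} ∨ S = {1} ∨ S = {2} ∨ S = {0, 1} ∨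
      S = {0, 2} ∨ S = {1, 2} ∨ S = {0, 1, 2} := by decide
  simp only [sum_signs, h₀, h₁, h₁', h₁'', h₂, h₂', h₂'', h₃]
  rcases hcases S with h | h | h | h | h | h | h | h
  · exact absurd h hS
  all_goals
    first
      -- Coordinate `0` serves for every `S` except `{0}`.
      | refine ⟨0, by subst h; decide, ?_⟩
      | refine ⟨1, by subst h; decide, ?_⟩
    subst h
    simp [signChar]
    constructor <;> linarith

/-! ### The equations of a central configuration of two nested cubes -/

/-- The distance from the vertex `1` of the cube of half edge `s` to the vertex `δ` of the
concentric cube of half edge `s'`. -/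
noncomputable def vertexDist (s s' : ℝ) (δ : Fin 3 → ℤˣ) : ℝ :=
  √(∑ k, (s' * ((δ k : ℤ) : ℝ) - s) ^ 2)

/-- The `k`-th coordinate of the attraction exerted on the vertex `1` of the cube of half edge `s`
by a unit mass at the vertex `δ` of the concentric cube of half edge `s'`. -/
noncomputable def vertexForce (k : Fin 3) (s s' : ℝ) (δ : Fin 3 → ℤˣ) : ℝ :=
  (s' * ((δ k : ℤ) : ℝ) - s) * (1 / vertexDist s s' δ ^ 3)

lemma vertexDist_comm (s s' : ℝ) (δ : Fin 3 → ℤˣ) : vertexDist s s' δ = vertexDist s' s δ := by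
  unfold vertexDist
  congr 1
  refine Finset.sum_congr rfl fun k _ => ?_
  rcases Int.units_eq_one_or (δ k) with h | h <;> rw [h] <;> push_cast <;> ring

lemma vertexDist_mul {c : ℝ} (hc : 0 ≤ c) (s s' : ℝ) (δ : Fin 3 → ℤˣ) :
    vertexDist (c * s) (c * s') δ = c * vertexDist s s' δ := by
  unfold vertexDist
  rw [← Real.sqrt_sq hc, ← Real.sqrt_mul (sq_nonneg c), Real.sqrt_sq hc, Finset.mul_sum]
  congr 1
  exact Finset.sum_congr rfl fun k _ => by ring

lemma vertexForce_mul {c : ℝ} (hc : 0 < c) (k : Fin 3) (s s' : ℝ) (δ : Fin 3 → ℤˣ) :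
    vertexForce k (c * s) (c * s') δ = (c ^ 2)⁻¹ * vertexForce k s s' δ := by
  unfold vertexForce
  rw [vertexDist_mul hc.le, mul_pow, one_div, one_div, mul_inv]
  field_simp

lemma sign_sq (u : ℤˣ) : ((u : ℤ) : ℝ) * ((u : ℤ) : ℝ) = 1 := by
  rcases Int.units_eq_one_or u with h | h <;> simp [h]

section

variable (a : EuclideanSpace ℝ (Fin 3))
  (b : OrthonormalBasis (Fin 3) ℝ (EuclideanSpace ℝ (Fin 3)))

lemma repr_cubeVertex_sub (s : ℝ) (ε : Fin 3 → ℤˣ) (k : Fin 3) :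
    b.repr (cubeVertex a b s ε - a) k = s * ((ε k : ℤ) : ℝ) := by
  simp [cubeVertex, b.repr_self, Finset.sum_apply, Pi.single_apply]

lemma repr_cubeVertex_sub_cubeVertex (s s' : ℝ) (ε η : Fin 3 → ℤˣ) (k : Fin 3) :
    b.repr (cubeVertex a b s' η - cubeVertex a b s ε) k =
      ((ε k : ℤ) : ℝ) * (s' * (((ε * η) k : ℤ) : ℝ) - s) := by
  rw [← sub_sub_sub_cancel_right _ _ a, map_sub, PiLp.sub_apply, repr_cubeVertex_sub,
    repr_cubeVertex_sub]
  simp only [Pi.mul_apply, Units.val_mul, Int.cast_mul]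
  linear_combination (-s' * ((η k : ℤ) : ℝ)) * sign_sq (ε k)

lemma norm_cubeVertex_sub_cubeVertex (s s' : ℝ) (ε η : Fin 3 → ℤˣ) :
    ‖cubeVertex a b s' η - cubeVertex a b s ε‖ = vertexDist s s' (ε * η) := by
  rw [← b.repr.norm_map, EuclideanSpace.norm_eq, vertexDist]
  congr 1
  refine Finset.sum_congr rfl fun k _ => ?_
  rw [repr_cubeVertex_sub_cubeVertex, Real.norm_eq_abs, sq_abs, mul_pow, sq (((ε k : ℤ) : ℝ)),
    sign_sq, one_mul]

/-- The reflection by `ε` moves the attracted vertex to `1` and the attracting one to `ε * η`; this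
is what produces a convolution. -/
lemma repr_attraction (μ s s' : ℝ) (ε η : Fin 3 → ℤˣ) (k : Fin 3) :
    ((ε k : ℤ) : ℝ) * b.repr ((μ / ‖cubeVertex a b s' η - cubeVertex a b s ε‖ ^ 3) •
      (cubeVertex a b s' η - cubeVertex a b s ε)) k = μ * vertexForce k s s' (ε * η) := by
  rw [map_smul, PiLp.smul_apply, repr_cubeVertex_sub_cubeVertex, norm_cubeVertex_sub_cubeVertex,
    vertexForce, smul_eq_mul]
  linear_combination (μ / vertexDist s s' (ε * η) ^ 3 * (s' * (((ε * η) k : ℤ) : ℝ) - s)) *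
    sign_sq (ε k)

/-- The equation at a vertex of one of the two cubes, in the Fourier transform. -/
lemma fourier_equation {r r' s lam : ℝ} {x y : (Fin 3 → ℤˣ) → ℝ} {q₀ : EuclideanSpace ℝ (Fin 3)}
    (h : ∀ ε, -lam • (cubeVertex a b s ε - q₀) =
      (∑ η, (x η / ‖cubeVertex a b r η - cubeVertex a b s ε‖ ^ 3) •
        (cubeVertex a b r η - cubeVertex a b s ε)) +
      ∑ η, (y η / ‖cubeVertex a b r' η - cubeVertex a b s ε‖ ^ 3) •
        (cubeVertex a b r' η - cubeVertex a b s ε))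
    {S : Finset (Fin 3)} {k : Fin 3} (hS : S ≠ ∅) (hSk : S ≠ {k}) :
    (∑ δ, signChar S δ * vertexForce k s r δ) * (∑ ε, signChar S ε * x ε) +
      (∑ δ, signChar S δ * vertexForce k s r' δ) * (∑ ε, signChar S ε * y ε) = 0 := by
  -- The left side is a combination of the characters of `∅` and `{k}` only, hence the two
  -- exclusions on `S`; the center of mass need not be known.
  have e : ∀ ε, -lam * (s - b.repr (q₀ - a) k * ((ε k : ℤ) : ℝ)) =
      (∑ η, x η * vertexForce k s r (ε * η)) + ∑ η, y η * vertexForce k s r' (ε * η) := by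
    intro ε
    simp only [← repr_attraction a b, ← Finset.mul_sum, ← mul_add]
    have h' := congrArg (fun v => b.repr v k) (h ε)
    simp only [map_add, map_sum, PiLp.add_apply, WithLp.ofLp_sum, Finset.sum_apply] at h'
    rw [← h', ← sub_sub_sub_cancel_right (cubeVertex a b s ε) q₀ a, map_smul,
      map_sub b.repr (cubeVertex a b s ε - a) (q₀ - a), PiLp.smul_apply, PiLp.sub_apply,
      repr_cubeVertex_sub, smul_eq_mul]
    linear_combination (lam * s) * sign_sq (ε k)
  rw [← sum_signChar_mul_convolution, ← sum_signChar_mul_convolution, ← Finset.sum_add_distrib]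
  simp only [← mul_add, ← e]
  calc ∑ ε, signChar S ε * (-lam * (s - b.repr (q₀ - a) k * ((ε k : ℤ) : ℝ)))
      = -lam * s * (∑ ε, signChar S ε) +
        lam * b.repr (q₀ - a) k * ∑ ε, signChar S ε * ((ε k : ℤ) : ℝ) := by
        rw [Finset.mul_sum, Finset.mul_sum, ← Finset.sum_add_distrib]
        exact Finset.sum_congr rfl fun ε _ => by ring
    _ = 0 := by rw [sum_signChar hS, sum_signChar_mul hSk, mul_zero, mul_zero, add_zero]

end

/-! ### Signs of the interaction coefficients and the 2×2 system -/

lemma exists_sum_vertexForce_neg_pos {t : ℝ} (ht0 : 0 < t) (ht1 : t < 1) {S : Finset (Fin 3)}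
    (hS : S ≠ ∅) :
    ∃ k, S ≠ {k} ∧ ∑ δ, signChar S δ * vertexForce k 1 t δ < 0 ∧
      0 < ∑ δ, signChar S δ * vertexForce k t 1 δ := by
  have hα : 0 < 1 - 2 * t / 3 + t ^ 2 := by nlinarith [sq_nonneg (t - 1)]
  have hβ : 0 < 1 + 2 * t / 3 + t ^ 2 := by positivity
  have hK := nestedKernel_of_sq ht0 ht1 (Real.sqrt_pos.2 hα) (Real.sqrt_pos.2 hβ)
    (Real.sq_sqrt hα.le) (Real.sq_sqrt hβ.le)
  have hd : ∀ (δ : Fin 3 → ℤˣ) (σ : ℝ), 0 ≤ σ →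
      ∑ k, (t * ((δ k : ℤ) : ℝ) - 1) ^ 2 = 3 * σ ^ 2 →
      √3 ^ 3 * (1 / vertexDist 1 t δ ^ 3) = 1 / σ ^ 3 := by
    intro δ σ hσ h
    rw [vertexDist, h, Real.sqrt_mul (by norm_num), Real.sqrt_sq hσ, mul_pow]
    field_simp
  have h1 : 0 ≤ 1 - t := by linarith
  have h2 : 0 ≤ 1 + t := by linarith
  obtain ⟨k, hk, hB, hC⟩ := exists_sum_signChar_neg_pos
    (w := fun δ => √3 ^ 3 * (1 / vertexDist 1 t δ ^ 3)) ht0 hK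
    (hd _ _ h1 (by simp [Fin.sum_univ_three]; ring))
    (hd _ _ (Real.sqrt_nonneg _) (by simp [Fin.sum_univ_three, Real.sq_sqrt hα.le]; ring))
    (hd _ _ (Real.sqrt_nonneg _) (by simp [Fin.sum_univ_three, Real.sq_sqrt hα.le]; ring))
    (hd _ _ (Real.sqrt_nonneg _) (by simp [Fin.sum_univ_three, Real.sq_sqrt hα.le]; ring))
    (hd _ _ (Real.sqrt_nonneg _) (by simp [Fin.sum_univ_three, Real.sq_sqrt hβ.le]; ring))
    (hd _ _ (Real.sqrt_nonneg _) (by simp [Fin.sum_univ_three, Real.sq_sqrt hβ.le]; ring))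
    (hd _ _ (Real.sqrt_nonneg _) (by simp [Fin.sum_univ_three, Real.sq_sqrt hβ.le]; ring))
    (hd _ _ h2 (by simp [Fin.sum_univ_three]; ring)) hS
  have h3 : 0 < √3 ^ 3 := by positivity
  refine ⟨k, hk, ?_, ?_⟩
  · refine neg_of_mul_neg_right (a := √3 ^ 3) ?_ h3.le
    rw [Finset.mul_sum]
    refine lt_of_eq_of_lt (Finset.sum_congr rfl fun δ _ => ?_) hB
    rw [vertexForce]
    ring
  · refine pos_of_mul_pos_right (a := √3 ^ 3) ?_ h3.le
    rw [Finset.mul_sum]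
    refine lt_of_lt_of_eq hC (Finset.sum_congr rfl fun δ _ => ?_)
    rw [vertexForce, vertexDist_comm t 1]
    ring

/-- The determinant `c * A ^ 2 - B * C` is positive whatever `A` is, so the interaction within one
cube never has to be computed. -/
lemma eq_zero_of_mul_neg {A D B C X Y c : ℝ} (hD : D = c * A) (hc : 0 ≤ c) (hB : B < 0)
    (hC : 0 < C) (h₁ : A * X + B * Y = 0) (h₂ : C * X + D * Y = 0) : X = 0 ∧ Y = 0 := by
  have hdet : 0 < c * A ^ 2 - B * C := by
    have := mul_neg_of_neg_of_pos hB hC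
    have := mul_nonneg hc (sq_nonneg A)
    linarith
  subst hD
  constructor
  · refine (mul_eq_zero.1 (?_ : (c * A ^ 2 - B * C) * X = 0)).resolve_left hdet.ne'
    linear_combination (c * A) * h₁ - B * h₂
  · refine (mul_eq_zero.1 (?_ : (c * A ^ 2 - B * C) * Y = 0)).resolve_left hdet.ne'
    linear_combination A * h₂ - C * h₁

theorem mainTheorem8
    (a : EuclideanSpace ℝ (Fin 3))
    (b : OrthonormalBasis (Fin 3) ℝ (EuclideanSpace ℝ (Fin 3)))
    (r : ℝ) (hr : 0 < r) (t : ℝ) (ht0 : 0 < t) (ht1 : t < 1)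
    (m : (Fin 3 → ℤˣ) ⊕ (Fin 3 → ℤˣ) → ℝ) (hm : ∀ i, 0 < m i)
    (hq : IsCentralConfiguration m (nestedCubes a b r t)) :
    (∀ v w : Fin 3 → ℤˣ, m (Sum.inl v) = m (Sum.inl w)) ∧
      (∀ v w : Fin 3 → ℤˣ, m (Sum.inr v) = m (Sum.inr w)) := by
  obtain ⟨lam, hq⟩ := hq
  -- The self-term is a multiple of the zero vector, so the sums may run over the whole group.
  simp only [fun i => Finset.sum_erase (f := fun j => (m j / ‖nestedCubes a b r t j -
    nestedCubes a b r t i‖ ^ 3) • (nestedCubes a b r t j - nestedCubes a b r t i))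
    (Finset.univ) (a := i) (by simp), Fintype.sum_sum_type] at hq
  have key : ∀ S : Finset (Fin 3), S ≠ ∅ → ∑ ε, signChar S ε * m (Sum.inl ε) = 0 ∧
      ∑ ε, signChar S ε * m (Sum.inr ε) = 0 := by
    intro S hS
    obtain ⟨k, hk, hB, hC⟩ := exists_sum_vertexForce_neg_pos ht0 ht1 hS
    have h₁ := fourier_equation a b (fun ε => hq (Sum.inl ε)) hS hk
    have h₂ := fourier_equation a b (fun ε => hq (Sum.inr ε)) hS hk
    have hr2 : 0 < (r ^ 2)⁻¹ := by positivity
    have scale : ∀ s s', ∑ δ, signChar S δ * vertexForce k (r * s) (r * s') δ =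
        (r ^ 2)⁻¹ * ∑ δ, signChar S δ * vertexForce k s s' δ := fun s s' => by
      rw [Finset.mul_sum]
      exact Finset.sum_congr rfl fun δ _ => by rw [vertexForce_mul hr]; ring
    refine eq_zero_of_mul_neg (c := (t ^ 2)⁻¹) ?_ (by positivity) ?_ ?_ h₁ h₂
    -- The force is homogeneous of degree `-2`, so the small cube's own coefficient is `(t ^ 2)⁻¹`
    -- times the large one's.
    · rw [Finset.mul_sum]
      exact Finset.sum_congr rfl fun δ _ => by rw [vertexForce_mul ht0]; ring
    · have := scale 1 t
      rw [mul_one, mul_comm r t] at this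
      rw [this]
      exact mul_neg_of_pos_of_neg hr2 hB
    · have := scale t 1
      rw [mul_one, mul_comm r t] at this
      rw [this]
      exact mul_pos hr2 hC
  exact ⟨eq_of_sum_signChar_mul_eq_zero fun S hS => (key S hS).1,
    eq_of_sum_signChar_mul_eq_zero fun S hS => (key S hS).2⟩
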